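/- Let $D$ be an infinite division ring (not necessarily commutative), let $n\ge 2$ be an integer, and let $G:=\mathrm{GL}_n(D)$ be the group of invertible $n\times n$ matrices over $D$. Let $\mathrm{SL}_n(D)$ be the subgroup of $G$ generated by the elementary matrices $I+c\,e_{ij}$ with $i\ne j$ and $c\in D$, where $e_{ij}$ denotes the matrix unit (equivalently, the kernel of the Dieudonné determinant on $G$). A subgroup $H$ of a group $G$ is called almost subnormal in $G$ if there is a finite chain of subgroups $H=H_r\le H_{r-1}\le\cdots\le H_1=G$ such that for each $1<i\le r$, either $H_i$ is normal in $H_{i-1}$ or $H_i$ has finite index in $H_{i-1}$; it is called subnormal if there is such a chain with $H_i$ normal in $H_{i-1}$ for each $1<i\le r$. Let $N$ be a non-central subgroup of $G$, that is, a subgroup not contained in the center of $G$. Then the following conditions are equivalent: 1. $N$ is almost subnormal in $G$. 2. $N$ is subnormal in $G$. 3. $N$ is normal in $G$. 4. $N$ contains $\mathrm{SL}_n(D)$. -/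

import Mathlib

/-- A subgroup `H` of `G` is almost subnormal (Hartley) if there is a finite descending chain
`G = S 0 ≥ S 1 ≥ ⋯ ≥ S r = H` of subgroups such that each `S (i + 1)` is normal in `S i` or has
finite index in `S i`. -/
def IsAlmostSubnormal {G : Type*} [Group G] (H : Subgroup G) : Prop :=
  ∃ (r : ℕ) (S : ℕ → Subgroup G), S 0 = ⊤ ∧ S r = H ∧
    ∀ i < r, S (i + 1) ≤ S i ∧
      (((S (i + 1)).subgroupOf (S i)).Normal ∨ ((S (i + 1)).subgroupOf (S i)).FiniteIndex)

/-- The special linear group `SL_n(D)` over a (possibly noncommutative) division ring `D`, as a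
subgroup of `GL_n(D)`: the subgroup generated by the elementary matrices `1 + c e_{ij}`, with
`i ≠ j` and `c` in `D`, where `e_{ij}` is the matrix unit (E. Artin's definition of the unimodular
group). For `2 ≤ n` it is the kernel of the Dieudonné determinant. -/
def specialLinearSubgroup (n : ℕ) (D : Type*) [DivisionRing D] :
    Subgroup (Matrix.GeneralLinearGroup (Fin n) D) :=
  Subgroup.closure {g | ∃ i j : Fin n, i ≠ j ∧ ∃ c : D,
    (g : Matrix (Fin n) (Fin n) D) = 1 + Matrix.single i j c}

/-!
Gaussian elimination reduces every invertible matrix, modulo `SL_n(D)`, to a dilation of any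
prescribed coordinate; dilations of two different coordinates commute, so `SL_n(D)` is normal with
abelian quotient, and every subgroup above it is normal.

Conversely, `SL_n(D)` acts doubly transitively on the lines of the column space `Dⁿ`, a right
`D`-space and hence a module over `Dᵐᵒᵖ`. It is perfect if `D` has more than three elements, and
generated by the abelian groups of transvections with a fixed direction, so by Iwasawa's criterion
its only normal subgroup moving a line is `SL_n(D)` itself. Two consequences carry `SL_n(D)` down an
almost subnormal chain. If `SL_n(D)` normalizes `N` and `g ∈ N` is not central, then `g` moves a
line, and so does its commutator with a suitable element of `SL_n(D)`; hence `SL_n(D) ≤ N`. If `D`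
is infinite and `K` has finite index in a group containing `SL_n(D)`, the pigeonhole principle puts
an elementary matrix `1 + c e_{ij}` with `c ≠ 0` into the normal core of `K ∩ SL_n(D)` in `SL_n(D)`;
hence `SL_n(D) ≤ K`.
-/

open Matrix Projectivization
open scoped commutatorElement LinearAlgebra.Projectivization Pointwise MatrixGroups

section ElementaryMatrices

variable {ι R : Type*} [Fintype ι] [DecidableEq ι] [Ring R]

/-- The elementary matrix `1 + c e_{ij}`, `i ≠ j`, as an element of the general linear group. -/
def elementaryUnit {i j : ι} (hij : i ≠ j) (c : R) : GL ι R where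
  val := 1 + single i j c
  inv := 1 + single i j (-c)
  val_inv := by
    simp [mul_add, add_mul, single_mul_single_of_ne, hij.symm, add_assoc, ← single_add]
  inv_val := by
    simp [mul_add, add_mul, single_mul_single_of_ne, hij.symm, add_assoc, ← single_add]

/-- The diagonal matrices with invertible entries, as elements of the general linear group. -/
def diagonalUnit : (ι → Rˣ) →* GL ι R :=
  (Units.map (diagonalRingHom ι R : (ι → R) →* Matrix ι ι R)).comp
    MulEquiv.piUnits.symm.toMonoidHom

lemma generalLinearGroup_ext_smul {g h : GL ι R} (H : ∀ v : ι → R, g • v = h • v) : g = h :=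
  Units.ext (ext_iff_smul.2 H)

lemma elementaryUnit_smul {i j : ι} (hij : i ≠ j) (c : R) (v : ι → R) :
    elementaryUnit hij c • v = v + Pi.single i (c * v j) := by
  change (1 + single i j c) *ᵥ v = _
  rw [add_mulVec, one_mulVec, single_mulVec]
  rfl

lemma diagonalUnit_smul (d : ι → Rˣ) (v : ι → R) : diagonalUnit d • v = d • v :=
  funext fun k => mulVec_diagonal _ _ k

lemma elementaryUnit_inv {i j : ι} (hij : i ≠ j) (c : R) :
    (elementaryUnit hij c)⁻¹ = elementaryUnit hij (-c) :=
  Units.ext rfl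

lemma elementaryUnit_mul {i j : ι} (hij : i ≠ j) (b c : R) :
    elementaryUnit hij b * elementaryUnit hij c = elementaryUnit hij (b + c) := by
  refine generalLinearGroup_ext_smul fun v => ?_
  simp [mul_smul, elementaryUnit_smul, hij.symm, add_mul, Pi.single_add, add_left_comm, add_comm]

lemma diagonalUnit_conj_elementaryUnit (d : ι → Rˣ) {i j : ι} (hij : i ≠ j) (c : R) :
    diagonalUnit d * elementaryUnit hij c * (diagonalUnit d)⁻¹ =
      elementaryUnit hij (d i * c * ↑(d j)⁻¹) := by
  rw [mul_inv_eq_iff_eq_mul]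
  refine generalLinearGroup_ext_smul fun v => ?_
  simp only [mul_smul, elementaryUnit_smul, diagonalUnit_smul]
  ext k
  rcases eq_or_ne k i with rfl | hk <;> simp [*, Units.smul_def, mul_assoc]

/-- Whitehead's lemma. -/
lemma diagonalUnit_mulSingle_mul_mulSingle_inv {i j : ι} (hij : i ≠ j) (a : Rˣ) :
    diagonalUnit (Pi.mulSingle i a * Pi.mulSingle j a⁻¹) =
      elementaryUnit hij.symm (↑a⁻¹ - 1 : R) * elementaryUnit hij 1 *
        elementaryUnit hij.symm (a - 1 : R) * elementaryUnit hij (-↑a⁻¹ : R) := by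
  refine generalLinearGroup_ext_smul fun v => ?_
  simp only [mul_smul, elementaryUnit_smul, diagonalUnit_smul]
  ext k
  rcases eq_or_ne k i with rfl | hi
  · simp [hij, hij.symm, Units.smul_def, sub_mul, mul_sub, mul_add]
    abel
  rcases eq_or_ne k j with rfl | hj
  · simp [hij, hij.symm, Units.smul_def, sub_mul, mul_sub, mul_add]
    abel
  · simp [hi, hj]

end ElementaryMatrices

section GaussianElimination

variable {ι R D : Type*} [Fintype ι] [DecidableEq ι] [Ring R] [DivisionRing D]

lemma exists_mem_smul_eq_add {M : Subgroup (GL ι R)}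
    (hM : ∀ i j (hij : i ≠ j) (c : R), elementaryUnit hij c ∈ M) {k : ι} {w : ι → R}
    (hw : w k = 0) : ∃ h ∈ M, ∀ x : ι → R, h • x = x + MulOpposite.op (x k) • w := by
  suffices H : ∀ s : Finset ι, k ∉ s → ∃ h ∈ M, ∀ x : ι → R,
      h • x = x + MulOpposite.op (x k) • ∑ i ∈ s, Pi.single i (w i) by
    obtain ⟨h, hh, H⟩ := H (Finset.univ.erase k) (Finset.notMem_erase _ _)
    have hsum : ∑ i ∈ Finset.univ.erase k, Pi.single i (w i) = w := by
      rw [Finset.sum_erase _ (by simp [hw]), Finset.univ_sum_single]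
    exact ⟨h, hh, by simpa only [hsum] using H⟩
  intro s hks
  induction s using Finset.induction_on with
  | empty => exact ⟨1, one_mem _, by simp⟩
  | insert j s hj ih =>
    obtain ⟨hjk, hks⟩ : j ≠ k ∧ k ∉ s := by simpa [eq_comm] using hks
    obtain ⟨h, hh, H⟩ := ih hks
    refine ⟨h * elementaryUnit hjk (w j), mul_mem hh (hM _ _ _ _), fun x => ?_⟩
    rw [mul_smul, elementaryUnit_smul, H, Finset.sum_insert hj, smul_add, ← Pi.single_smul]
    simp [hjk.symm, add_assoc]

lemma exists_mem_smul_eq_single_of_apply_ne_zero {M : Subgroup (GL ι D)}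
    (hM : ∀ i j (hij : i ≠ j) (c : D), elementaryUnit hij c ∈ M)
    (hM' : ∀ i a, diagonalUnit (Pi.mulSingle i a) ∈ M) {k : ι} {v : ι → D} (hv : v k ≠ 0) :
    ∃ h ∈ M, (∀ x : ι → D, x k = 0 → h • x = x) ∧ h • v = Pi.single k 1 := by
  obtain ⟨h, hh, H⟩ := exists_mem_smul_eq_add hM (k := k)
    (w := Pi.single k 1 - MulOpposite.op (v k)⁻¹ • v) (by simp [hv])
  have hv' : h • v = Pi.single k (v k) := by
    rw [H, smul_sub, smul_smul, ← MulOpposite.op_mul, inv_mul_cancel₀ hv, ← Pi.single_smul]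
    simp
  refine ⟨diagonalUnit (Pi.mulSingle k (Units.mk0 (v k) hv)⁻¹) * h,
    mul_mem (hM' _ _) hh, fun x hx => ?_, ?_⟩
  · rw [mul_smul, H, hx, diagonalUnit_smul]
    ext i
    rcases eq_or_ne i k with rfl | hi <;> simp [*]
  · rw [mul_smul, hv', diagonalUnit_smul]
    ext i
    rcases eq_or_ne i k with rfl | hi <;> simp [*, Units.smul_def]

lemma exists_mem_smul_eq_single {M : Subgroup (GL ι D)}
    (hM : ∀ i j (hij : i ≠ j) (c : D), elementaryUnit hij c ∈ M)
    (hM' : ∀ i a, diagonalUnit (Pi.mulSingle i a) ∈ M) {j k : ι} {v : ι → D} (hv : v j ≠ 0) :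
    ∃ h ∈ M, (∀ x : ι → D, x j = 0 → x k = 0 → h • x = x) ∧ h • v = Pi.single k 1 := by
  by_cases hvk : v k = 0
  · have hkj : k ≠ j := by rintro rfl; exact hv hvk
    obtain ⟨h, hh, H, Hv⟩ := exists_mem_smul_eq_single_of_apply_ne_zero hM hM'
      (k := k) (v := elementaryUnit hkj (1 : D) • v) (by simpa [elementaryUnit_smul, hvk] using hv)
    refine ⟨h * elementaryUnit hkj (1 : D), mul_mem hh (hM _ _ _ _), fun x hxj hxk => ?_, ?_⟩
    · have hx : elementaryUnit hkj (1 : D) • x = x := by simp [elementaryUnit_smul, hxj]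
      rw [mul_smul, hx, H x hxk]
    · rw [mul_smul, Hv]
  · obtain ⟨h, hh, H, Hv⟩ := exists_mem_smul_eq_single_of_apply_ne_zero hM hM' hvk
    exact ⟨h, hh, fun x _ => H x, Hv⟩

lemma generalLinearGroup_smul_eq_sum (g : GL ι R) (v : ι → R) :
    g • v = ∑ i, MulOpposite.op (v i) • g • (Pi.single i 1 : ι → R) := by
  conv_lhs => rw [← Finset.univ_sum_single v, Finset.smul_sum]
  refine Finset.sum_congr rfl fun i _ => ?_
  rw [smul_comm, ← Pi.single_smul]
  simp

lemma exists_notMem_smul_single_apply_ne_zero [Nontrivial R] {g : GL ι R} {S : Finset ι}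
    (hS : ∀ i ∈ S, g • (Pi.single i 1 : ι → R) = Pi.single i 1) {k : ι} (hk : k ∉ S) :
    ∃ j ∉ S, (g • (Pi.single k 1 : ι → R)) j ≠ 0 := by
  by_contra! H
  set v := g • (Pi.single k 1 : ι → R) with hv
  have hgv : g • v = v := by
    conv_rhs => rw [← one_smul (GL ι R) v, generalLinearGroup_smul_eq_sum]
    rw [generalLinearGroup_smul_eq_sum]
    refine Finset.sum_congr rfl fun i _ => ?_
    by_cases hi : i ∈ S
    · rw [hS i hi, one_smul]
    · simp [H i hi]
  have hvk : v = Pi.single k 1 := MulAction.injective g (hgv.trans hv)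
  simpa [hvk] using H k hk

/-- Gaussian elimination: the columns of a matrix are brought to those of the identity one by one,
by row operations that do not affect the columns already treated. -/
theorem eq_top_of_elementaryUnit_mem_of_diagonalUnit_mem {M : Subgroup (GL ι D)}
    (hM : ∀ i j (hij : i ≠ j) (c : D), elementaryUnit hij c ∈ M)
    (hM' : ∀ i a, diagonalUnit (Pi.mulSingle i a) ∈ M) : M = ⊤ := by
  refine Subgroup.eq_top_iff' _ |>.2 fun g => ?_
  have H : ∀ S : Finset ι, ∃ h ∈ M, ∀ i ∈ S, (h * g) • (Pi.single i 1 : ι → D) = Pi.single i 1 := by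
    intro S
    induction S using Finset.induction_on with
    | empty => exact ⟨1, one_mem _, by simp⟩
    | insert k S hk ih =>
      obtain ⟨h, hh, H⟩ := ih
      obtain ⟨j, hj, hne⟩ := exists_notMem_smul_single_apply_ne_zero H hk
      obtain ⟨h', hh', H', he⟩ := exists_mem_smul_eq_single hM hM' (k := k) hne
      refine ⟨h' * h, mul_mem hh' hh, fun i hi => ?_⟩
      rw [mul_assoc, mul_smul]
      rcases Finset.mem_insert.1 hi with rfl | hi
      · exact he
      · rw [H i hi, H' _ (Pi.single_eq_of_ne (ne_of_mem_of_not_mem hi hj).symm _)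
          (Pi.single_eq_of_ne (ne_of_mem_of_not_mem hi hk).symm _)]
  obtain ⟨h, hh, H⟩ := H Finset.univ
  have hg : h * g = 1 := generalLinearGroup_ext_smul fun v => by
    simp only [generalLinearGroup_smul_eq_sum _ v, H _ (Finset.mem_univ _), one_smul]
  exact eq_inv_of_mul_eq_one_right hg ▸ inv_mem hh

end GaussianElimination

section SpecialLinearSubgroup

variable {n : ℕ} {D : Type*} [DivisionRing D]

lemma elementaryUnit_mem {i j : Fin n} (hij : i ≠ j) (c : D) :
    elementaryUnit hij c ∈ specialLinearSubgroup n D :=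
  Subgroup.subset_closure ⟨i, j, hij, c, rfl⟩

lemma specialLinearSubgroup_le_iff {K : Subgroup (GL (Fin n) D)} :
    specialLinearSubgroup n D ≤ K ↔ ∀ i j (hij : i ≠ j) (c : D), elementaryUnit hij c ∈ K := by
  refine ⟨fun h i j hij c => h (elementaryUnit_mem hij c), fun h => ?_⟩
  rw [specialLinearSubgroup, Subgroup.closure_le]
  rintro g ⟨i, j, hij, c, hg⟩
  rw [show g = elementaryUnit hij c from Units.ext hg]
  exact h i j hij c

lemma diagonalUnit_mulSingle_mul_mulSingle_inv_mem {i j : Fin n} (hij : i ≠ j) (a : Dˣ) :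
    diagonalUnit (Pi.mulSingle i a * Pi.mulSingle j a⁻¹) ∈ specialLinearSubgroup n D := by
  rw [diagonalUnit_mulSingle_mul_mulSingle_inv hij]
  exact mul_mem (mul_mem (mul_mem (elementaryUnit_mem _ _) (elementaryUnit_mem _ _))
    (elementaryUnit_mem _ _)) (elementaryUnit_mem _ _)

instance specialLinearSubgroup_normal : (specialLinearSubgroup n D).Normal := by
  have hdiag (d : Fin n → Dˣ) : specialLinearSubgroup n D ≤
      (specialLinearSubgroup n D).comap (MulAut.conj (diagonalUnit d)).toMonoidHom :=
    specialLinearSubgroup_le_iff.2 fun i j hij c => by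
      simpa [diagonalUnit_conj_elementaryUnit] using elementaryUnit_mem hij _
  rw [← Subgroup.normalizer_eq_top_iff]
  refine eq_top_of_elementaryUnit_mem_of_diagonalUnit_mem
    (fun i j hij c => Subgroup.le_normalizer (elementaryUnit_mem hij c)) fun i a => ?_
  refine Subgroup.mem_normalizer_iff.2 fun g => ⟨fun hg => hdiag _ hg, fun hg => ?_⟩
  have := hdiag (Pi.mulSingle i a)⁻¹ hg
  simpa [mul_assoc] using this

lemma exists_mem_mul_diagonalUnit_eq (z : Fin n) (g : GL (Fin n) D) :
    ∃ h ∈ specialLinearSubgroup n D, ∃ a : Dˣ, h * diagonalUnit (Pi.mulSingle z a) = g := by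
  have htop : specialLinearSubgroup n D ⊔
      (diagonalUnit.comp (MonoidHom.mulSingle (fun _ : Fin n => Dˣ) z)).range = ⊤ := by
    refine eq_top_of_elementaryUnit_mem_of_diagonalUnit_mem
      (fun i j hij c => Subgroup.mem_sup_left (elementaryUnit_mem hij c)) fun i a => ?_
    rcases eq_or_ne i z with rfl | hiz
    · exact Subgroup.mem_sup_right ⟨a, rfl⟩
    · have hsplit : (Pi.mulSingle i a : Fin n → Dˣ) =
          Pi.mulSingle i a * Pi.mulSingle z a⁻¹ * Pi.mulSingle z a := by
        rw [mul_assoc, ← Pi.mulSingle_mul, inv_mul_cancel, Pi.mulSingle_one, mul_one]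
      rw [hsplit, map_mul]
      exact Subgroup.mul_mem_sup (diagonalUnit_mulSingle_mul_mulSingle_inv_mem hiz a) ⟨a, rfl⟩
  obtain ⟨h, hh, _, ⟨a, rfl⟩, hg⟩ := Subgroup.mem_sup_of_normal_left.1 (htop ▸ Subgroup.mem_top g)
  exact ⟨h, hh, a, hg⟩

lemma commute_map_of_specialLinearSubgroup_le_ker [Nontrivial (Fin n)] {Q : Type*} [Group Q]
    {π : GL (Fin n) D →* Q} (hπ : specialLinearSubgroup n D ≤ π.ker) (g₁ g₂ : GL (Fin n) D) :
    Commute (π g₁) (π g₂) := by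
  obtain ⟨z, y, hzy⟩ := exists_pair_ne (Fin n)
  obtain ⟨h₁, hh₁, a, rfl⟩ := exists_mem_mul_diagonalUnit_eq z g₁
  obtain ⟨h₂, hh₂, b, rfl⟩ := exists_mem_mul_diagonalUnit_eq y g₂
  rw [map_mul, map_mul, MonoidHom.mem_ker.1 (hπ hh₁), MonoidHom.mem_ker.1 (hπ hh₂), one_mul,
    one_mul]
  exact ((Pi.mulSingle_commute hzy a b).map diagonalUnit).map π

lemma commutator_le_specialLinearSubgroup [Nontrivial (Fin n)] :
    commutator (GL (Fin n) D) ≤ specialLinearSubgroup n D := by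
  have hker := QuotientGroup.ker_mk' (specialLinearSubgroup n D)
  rw [← hker, commutator_def, Subgroup.commutator_le]
  intro g₁ _ g₂ _
  rw [MonoidHom.mem_ker, map_commutatorElement, commutatorElement_eq_one_iff_commute]
  exact commute_map_of_specialLinearSubgroup_le_ker hker.ge g₁ g₂

lemma normal_of_specialLinearSubgroup_le [Nontrivial (Fin n)] {N : Subgroup (GL (Fin n) D)}
    (hN : specialLinearSubgroup n D ≤ N) : N.Normal :=
  Subgroup.Normal.of_commutator_le _ (commutator_le_specialLinearSubgroup.trans hN)

lemma elementaryUnit_mem_commutator {i j : Fin n} (hij : i ≠ j) {c : D} {a : Dˣ}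
    (hac : Commute (a : D) c) (ha : (a : D) * a ≠ 1) :
    elementaryUnit hij c ∈ ⁅specialLinearSubgroup n D, specialLinearSubgroup n D⁆ := by
  set b : D := ((a : D) * a - 1)⁻¹ * c
  have hab : Commute (a : D) b := by
    refine Commute.mul_right (Commute.inv_right₀ ?_) hac
    exact ((Commute.refl (a : D)).mul_right (Commute.refl _)).sub_right (Commute.one_right _)
  have hb : (a : D) * b * a + -b = c := by
    rw [mul_assoc, ← hab.eq, ← mul_assoc, ← sub_eq_add_neg, ← sub_one_mul,
      mul_inv_cancel_left₀ (sub_ne_zero.2 ha)]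
  have hcomm : elementaryUnit hij c =
      ⁅diagonalUnit (Pi.mulSingle i a * Pi.mulSingle j a⁻¹), elementaryUnit hij b⁆ := by
    rw [commutatorElement_def, diagonalUnit_conj_elementaryUnit, elementaryUnit_inv,
      elementaryUnit_mul]
    simp [hij, hij.symm, hb]
  rw [hcomm]
  exact Subgroup.commutator_mem_commutator (diagonalUnit_mulSingle_mul_mulSingle_inv_mem hij a)
    (elementaryUnit_mem hij b)

lemma exists_commute_mul_self_ne_one (hD : 3 < ENat.card D) (c : D) :
    ∃ a : Dˣ, Commute (a : D) c ∧ (a : D) * a ≠ 1 := by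
  classical
  by_cases hc : c ∈ ({0, 1, -1} : Finset D)
  · obtain ⟨a, ha⟩ : ∃ a : D, a ∉ ({0, 1, -1} : Finset D) := by
      by_contra! H
      have hle : ENat.card D ≤ (({0, 1, -1} : Finset D) : Set D).encard :=
        Set.encard_univ D ▸ Set.encard_le_encard fun a _ => H a
      rw [Set.encard_coe_eq_coe_finsetCard] at hle
      exact hD.not_ge (hle.trans (mod_cast Finset.card_le_three))
    simp only [Finset.mem_insert, Finset.mem_singleton, not_or] at ha hc
    refine ⟨Units.mk0 a ha.1, ?_, by simpa [mul_self_eq_one_iff] using ha.2⟩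
    rcases hc with rfl | rfl | rfl <;> simp
  · simp only [Finset.mem_insert, Finset.mem_singleton, not_or] at hc
    exact ⟨Units.mk0 c hc.1, Commute.refl _, by simpa [mul_self_eq_one_iff] using hc.2⟩

lemma commutator_specialLinearSubgroup (hD : 3 < ENat.card D) :
    commutator (specialLinearSubgroup n D) = ⊤ := by
  rw [eq_top_iff, ← Subgroup.map_subtype_le_map_subtype, Subgroup.map_subtype_commutator,
    ← MonoidHom.range_eq_map, Subgroup.range_subtype, specialLinearSubgroup_le_iff]
  intro i j hij c
  obtain ⟨a, hac, ha⟩ := exists_commute_mul_self_ne_one hD c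
  exact elementaryUnit_mem_commutator hij hac ha

end SpecialLinearSubgroup

section LinesOfColumnSpace

variable {ι R D : Type*} [Fintype ι] [DecidableEq ι] [Ring R] [DivisionRing D]

lemma exists_generalLinearGroup_smul_eq (f : (ι → R) ≃ₗ[Rᵐᵒᵖ] (ι → R)) :
    ∃ g : GL ι R, ∀ v : ι → R, g • v = f v := by
  let e : Module.End Rᵐᵒᵖ (ι → R) ≃+* Matrix ι ι R :=
    (endVecRingEquivMatrixEnd ι Rᵐᵒᵖ R).trans (RingEquiv.moduleEndSelfOp R).symm.mapMatrix
  have he (F : Module.End Rᵐᵒᵖ (ι → R)) (v : ι → R) : e F • v = F v :=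
    LinearMap.congr_fun (e.symm_apply_apply F) v
  exact ⟨Units.map (e : Module.End Rᵐᵒᵖ (ι → R) →* Matrix ι ι R)
    (LinearMap.GeneralLinearGroup.ofLinearEquiv f), he f⟩

instance : MulAction.IsMultiplyPretransitive (GL ι D) (ℙ Dᵐᵒᵖ (ι → D)) 2 := by
  rw [MulAction.is_two_pretransitive_iff]
  intro a b a' b' hab hab'
  obtain ⟨f, hfa, hfb⟩ := MulAction.is_two_pretransitive_iff.1
    (linearEquiv_is_two_pretransitive Dᵐᵒᵖ (ι → D)) hab hab'
  obtain ⟨g, hg⟩ := exists_generalLinearGroup_smul_eq f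
  have hgf (l : ℙ Dᵐᵒᵖ (ι → D)) : g • l = f • l := by
    induction l with | h v hv => simp only [smul_mk, hg, LinearEquiv.smul_def]
  exact ⟨g, by rw [hgf, hfa], by rw [hgf, hfb]⟩

lemma mem_center_of_forall_smul_eq [Nontrivial ι] {g : GL ι D}
    (hg : ∀ l : ℙ Dᵐᵒᵖ (ι → D), g • l = l) : g ∈ Subgroup.center (GL ι D) := by
  let b : Module.Basis ι Dᵐᵒᵖ (ι → D) :=
    .ofEquivFun (.piCongrRight fun _ => MulOpposite.opLinearEquiv Dᵐᵒᵖ)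
  obtain ⟨c, hc⟩ :=
    LinearMap.exists_mem_center_apply_eq_smul_of_forall_notLinearIndependent_of_basis
    (f := DistribSMul.toLinearMap Dᵐᵒᵖ (ι → D) g) b fun v => by
      by_cases hv : v = 0
      · simp [hv, linearIndependent_fin2]
      · simpa [LinearIndependent.pair_iff' hv, mk_eq_mk_iff'] using hg (.mk Dᵐᵒᵖ v hv)
  have hgc (v : ι → D) : g • v = (c : Dᵐᵒᵖ) • v := LinearMap.congr_fun hc v
  refine Subgroup.mem_center_iff.2 fun h => generalLinearGroup_ext_smul fun v => ?_
  rw [mul_smul, mul_smul, hgc, hgc, smul_comm]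

lemma smul_mem_submodule_smul_iff {g : GL ι D} {l : ℙ Dᵐᵒᵖ (ι → D)} {w : ι → D} :
    g • w ∈ (g • l).submodule ↔ w ∈ l.submodule := by
  induction l with | h v hv =>
  simp only [smul_mk, submodule_mk, Submodule.mem_span_singleton]
  refine exists_congr fun c => ?_
  rw [← smul_comm, (MulAction.injective g).eq_iff]

/-- The line spanned by the `i`-th standard basis vector of the space of columns, which is a right
vector space. -/
def coordinateLine (D : Type*) [DivisionRing D] (i : ι) : ℙ Dᵐᵒᵖ (ι → D) :=
  mk Dᵐᵒᵖ (Pi.single i 1) (by simp)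

omit [Fintype ι] in
lemma coordinateLine_injective : Function.Injective (coordinateLine (ι := ι) D) := by
  intro i j h
  obtain ⟨a, ha⟩ := (mk_eq_mk_iff' ..).1 h
  by_contra hij
  simpa [hij] using congrFun ha i

lemma diagonalUnit_smul_coordinateLine (d : ι → Dˣ) (i : ι) :
    diagonalUnit d • coordinateLine D i = coordinateLine D i := by
  rw [coordinateLine, smul_mk, mk_eq_mk_iff']
  refine ⟨MulOpposite.op (d i : D), ?_⟩
  rw [diagonalUnit_smul, ← Pi.single_smul]
  ext k
  rcases eq_or_ne k i with rfl | hk <;> simp [*, Units.smul_def]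

lemma elementaryUnit_smul_coordinateLine_left {i j : ι} (hij : i ≠ j) (c : D) :
    elementaryUnit hij c • coordinateLine D i = coordinateLine D i := by
  simp [coordinateLine, elementaryUnit_smul, hij.symm]

lemma elementaryUnit_smul_coordinateLine_right_eq_iff {i j : ι} (hij : i ≠ j) {c : D} :
    elementaryUnit hij c • coordinateLine D j = coordinateLine D j ↔ c = 0 := by
  refine ⟨fun h => ?_, ?_⟩
  · obtain ⟨a, ha⟩ := (mk_eq_mk_iff' ..).1 h
    simpa [elementaryUnit_smul, hij, hij.symm] using (congrFun ha i).symm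
  · rintro rfl
    simp [coordinateLine, elementaryUnit_smul]

end LinesOfColumnSpace

section IwasawaCriterion

variable {n : ℕ} {D : Type*} [DivisionRing D]

lemma exists_smul_coordinateLine_eq {i j : Fin n} (hij : i ≠ j) {a b : ℙ Dᵐᵒᵖ (Fin n → D)}
    (hab : a ≠ b) : ∃ s : specialLinearSubgroup n D,
      s • coordinateLine D i = a ∧ s • coordinateLine D j = b := by
  obtain ⟨g, rfl, rfl⟩ := MulAction.is_two_pretransitive_iff.1
    (inferInstance : MulAction.IsMultiplyPretransitive (GL (Fin n) D) _ 2)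
    (coordinateLine_injective.ne hij) hab
  obtain ⟨s, hs, c, rfl⟩ := exists_mem_mul_diagonalUnit_eq i g
  refine ⟨⟨s, hs⟩, ?_, ?_⟩ <;> rw [mul_smul, diagonalUnit_smul_coordinateLine] <;> rfl

instance [Nontrivial (Fin n)] :
    MulAction.IsMultiplyPretransitive (specialLinearSubgroup n D) (ℙ Dᵐᵒᵖ (Fin n → D)) 2 := by
  rw [MulAction.is_two_pretransitive_iff]
  intro a b a' b' hab hab'
  obtain ⟨i, j, hij⟩ := exists_pair_ne (Fin n)
  obtain ⟨s, rfl, rfl⟩ := exists_smul_coordinateLine_eq hij hab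
  obtain ⟨t, rfl, rfl⟩ := exists_smul_coordinateLine_eq hij hab'
  exact ⟨t * s⁻¹, by rw [mul_smul, inv_smul_smul], by rw [mul_smul, inv_smul_smul]⟩

instance [Nontrivial (Fin n)] :
    MulAction.IsPreprimitive (specialLinearSubgroup n D) (ℙ Dᵐᵒᵖ (Fin n → D)) :=
  MulAction.isPreprimitive_of_is_two_pretransitive inferInstance

/-- The transvections with direction `l`, i.e. the maps acting trivially on the line `l` and on the
quotient by `l`: the abelian subgroups to which the Iwasawa criterion is applied. -/
def transvectionSubgroup (l : ℙ Dᵐᵒᵖ (Fin n → D)) : Subgroup (specialLinearSubgroup n D) where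
  carrier := {x | (∀ w : Fin n → D, x • w - w ∈ l.submodule) ∧ ∀ w ∈ l.submodule, x • w = w}
  one_mem' := by simp
  mul_mem' := by
    rintro x y ⟨hx, hx'⟩ ⟨hy, hy'⟩
    refine ⟨fun w => ?_, fun w hw => by rw [mul_smul, hy' w hw, hx' w hw]⟩
    rw [mul_smul, ← sub_add_sub_cancel _ (y • w)]
    exact add_mem (hx _) (hy _)
  inv_mem' := by
    rintro x ⟨hx, hx'⟩
    refine ⟨fun w => ?_, fun w hw => by rw [inv_smul_eq_iff, hx' w hw]⟩
    rw [← neg_sub, neg_mem_iff]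
    simpa using hx (x⁻¹ • w)

lemma mem_transvectionSubgroup {l : ℙ Dᵐᵒᵖ (Fin n → D)} {x : specialLinearSubgroup n D} :
    x ∈ transvectionSubgroup l ↔
      (∀ w : Fin n → D, x • w - w ∈ l.submodule) ∧ ∀ w ∈ l.submodule, x • w = w :=
  Iff.rfl

lemma commute_of_mem_transvectionSubgroup {l : ℙ Dᵐᵒᵖ (Fin n → D)}
    {x y : specialLinearSubgroup n D} (hx : x ∈ transvectionSubgroup l)
    (hy : y ∈ transvectionSubgroup l) : Commute x y := by
  refine Subtype.ext (generalLinearGroup_ext_smul fun w => ?_)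
  change (x * y) • w = (y * x) • w
  have hxy : x • (y • w - w) = y • w - w := hx.2 _ (hy.1 w)
  have hyx : y • (x • w - w) = x • w - w := hy.2 _ (hx.1 w)
  rw [smul_sub, sub_eq_iff_eq_add] at hxy hyx
  rw [mul_smul, mul_smul, hxy, hyx]
  abel

lemma transvectionSubgroup_smul (g : specialLinearSubgroup n D) (l : ℙ Dᵐᵒᵖ (Fin n → D)) :
    transvectionSubgroup (g • l) = MulAut.conj g • transvectionSubgroup l := by
  have hmem (w : Fin n → D) : g • w ∈ (g • l).submodule ↔ w ∈ l.submodule :=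
    smul_mem_submodule_smul_iff (g := (g : GL (Fin n) D))
  have hsmul : Function.Surjective fun w : Fin n → D => g • w := MulAction.surjective g
  ext x
  rw [Subgroup.mem_pointwise_smul_iff_inv_smul_mem, ← map_inv, MulAut.smul_def, MulAut.conj_apply,
    inv_inv, mem_transvectionSubgroup, mem_transvectionSubgroup]
  refine and_congr (hsmul.forall.trans (forall_congr' fun w => ?_))
    (hsmul.forall.trans (forall_congr' fun w => ?_))
  · rw [← hmem, smul_sub, mul_smul, mul_smul, smul_inv_smul]
  · rw [hmem, mul_smul, mul_smul, inv_smul_eq_iff]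

lemma elementaryUnit_mem_transvectionSubgroup {i j : Fin n} (hij : i ≠ j) (c : D) :
    (⟨elementaryUnit hij c, elementaryUnit_mem hij c⟩ : specialLinearSubgroup n D) ∈
      transvectionSubgroup (coordinateLine D i) := by
  rw [mem_transvectionSubgroup, coordinateLine, submodule_mk]
  simp only [Subgroup.mk_smul, elementaryUnit_smul, add_sub_cancel_left]
  refine ⟨fun w => Submodule.mem_span_singleton.2 ⟨.op (c * w j), ?_⟩, fun w hw => ?_⟩
  · simp [← Pi.single_smul]
  · obtain ⟨d, rfl⟩ := Submodule.mem_span_singleton.1 hw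
    simp [hij.symm]

/-- The Iwasawa structure formed by the transvection subgroups. -/
def transvectionIwasawaStructure :
    MulAction.IwasawaStructure (specialLinearSubgroup n D) (ℙ Dᵐᵒᵖ (Fin n → D)) where
  T := transvectionSubgroup
  is_comm _ := ⟨⟨fun x y => Subtype.ext (commute_of_mem_transvectionSubgroup x.2 y.2)⟩⟩
  is_conj := transvectionSubgroup_smul
  is_generator := by
    rw [eq_top_iff, ← Subgroup.map_subtype_le_map_subtype, ← MonoidHom.range_eq_map,
      Subgroup.range_subtype, specialLinearSubgroup_le_iff]
    exact fun i j hij c =>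
      ⟨_, le_iSup transvectionSubgroup _ (elementaryUnit_mem_transvectionSubgroup hij c), rfl⟩

theorem eq_top_of_normal_of_smul_ne [Nontrivial (Fin n)] (hD : 3 < ENat.card D)
    {K : Subgroup (specialLinearSubgroup n D)} [K.Normal] {x : specialLinearSubgroup n D}
    (hx : x ∈ K) {l : ℙ Dᵐᵒᵖ (Fin n → D)} (hl : x • l ≠ l) : K = ⊤ := by
  rw [eq_top_iff, ← commutator_specialLinearSubgroup hD]
  exact transvectionIwasawaStructure.commutator_le K
    fun h => hl (Set.eq_univ_iff_forall.1 h l ⟨x, hx⟩)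

end IwasawaCriterion

section AlmostSubnormal

variable {n : ℕ} {D : Type*} [DivisionRing D] [Nontrivial (Fin n)]

lemma exists_smul_eq_and_smul_ne {l l' : ℙ Dᵐᵒᵖ (Fin n → D)} (h : l ≠ l') :
    ∃ s : specialLinearSubgroup n D, s • l = l ∧ s • l' ≠ l' := by
  obtain ⟨i, j, hij⟩ := exists_pair_ne (Fin n)
  obtain ⟨r, rfl, rfl⟩ := exists_smul_coordinateLine_eq hij h
  let t : specialLinearSubgroup n D := ⟨elementaryUnit hij 1, elementaryUnit_mem hij 1⟩
  have ht : t • coordinateLine D i = coordinateLine D i :=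
    elementaryUnit_smul_coordinateLine_left hij 1
  have ht' : t • coordinateLine D j ≠ coordinateLine D j :=
    (elementaryUnit_smul_coordinateLine_right_eq_iff hij).not.2 one_ne_zero
  refine ⟨r * t * r⁻¹, ?_, ?_⟩
  · rw [mul_smul, mul_smul, inv_smul_smul, ht]
  · rwa [mul_smul, mul_smul, inv_smul_smul, (MulAction.injective r).ne_iff]

theorem specialLinearSubgroup_le_of_le_normalizer (hD : 3 < ENat.card D)
    {N : Subgroup (GL (Fin n) D)} (hN : ¬ N ≤ Subgroup.center (GL (Fin n) D))
    (hnorm : specialLinearSubgroup n D ≤ Subgroup.normalizer N) :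
    specialLinearSubgroup n D ≤ N := by
  obtain ⟨g, hg, hgc⟩ := SetLike.not_le_iff_exists.1 hN
  obtain ⟨l, hl⟩ : ∃ l : ℙ Dᵐᵒᵖ (Fin n → D), g • l ≠ l := by
    by_contra! H
    exact hgc (mem_center_of_forall_smul_eq H)
  obtain ⟨s, hsl, hsgl⟩ := exists_smul_eq_and_smul_ne hl.symm
  have hsN : ⁅(s : GL (Fin n) D), g⁆ ∈ N :=
    mul_mem ((Subgroup.mem_normalizer_iff.1 (hnorm s.2) g).1 hg) (inv_mem hg)
  have hsS : ⁅(s : GL (Fin n) D), g⁆ ∈ specialLinearSubgroup n D :=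
    Subgroup.commutator_le_left _ ⊤
      (Subgroup.commutator_mem_commutator s.2 (Subgroup.mem_top g))
  have hmoves : (⟨_, hsS⟩ : specialLinearSubgroup n D) • g • l ≠ g • l := by
    have hsl' : (s : GL (Fin n) D)⁻¹ • l = l := inv_smul_eq_iff.2 hsl.symm
    rw [Subgroup.mk_smul, commutatorElement_def, mul_smul, mul_smul, mul_smul, inv_smul_smul, hsl']
    exact hsgl
  have := Subgroup.normal_subgroupOf_of_le_normalizer hnorm
  exact Subgroup.subgroupOf_eq_top.1
    (eq_top_of_normal_of_smul_ne hD (Subgroup.mem_subgroupOf.2 hsN) hmoves)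

variable [Infinite D]

theorem specialLinearSubgroup_le_of_relIndex_ne_zero {K : Subgroup (GL (Fin n) D)}
    (hK : K.relIndex (specialLinearSubgroup n D) ≠ 0) : specialLinearSubgroup n D ≤ K := by
  obtain ⟨i, j, hij⟩ := exists_pair_ne (Fin n)
  have : (K.subgroupOf (specialLinearSubgroup n D)).FiniteIndex := ⟨hK⟩
  set C := (K.subgroupOf (specialLinearSubgroup n D)).normalCore
  let t (c : D) : specialLinearSubgroup n D := ⟨elementaryUnit hij c, elementaryUnit_mem hij c⟩
  obtain ⟨b, c, hbc, h⟩ := Finite.exists_ne_map_eq_of_infinite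
    fun c => (t c : specialLinearSubgroup n D ⧸ C)
  have ht : (t b)⁻¹ * t c = t (-b + c) :=
    Subtype.ext (by simp [t, elementaryUnit_inv, elementaryUnit_mul])
  have hmoves : t (-b + c) • coordinateLine D j ≠ coordinateLine D j :=
    (elementaryUnit_smul_coordinateLine_right_eq_iff hij).not.2 (neg_add_eq_zero.not.2 hbc)
  have hD : 3 < ENat.card D := ENat.card_eq_top_of_infinite (α := D) ▸ ENat.natCast_lt_top 3
  have htop : C = ⊤ := eq_top_of_normal_of_smul_ne hD (ht ▸ QuotientGroup.eq.1 h) hmoves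
  rw [← Subgroup.subgroupOf_eq_top, eq_top_iff, ← htop]
  exact Subgroup.normalCore_le _

theorem IsAlmostSubnormal.specialLinearSubgroup_le {N : Subgroup (GL (Fin n) D)}
    (hsub : IsAlmostSubnormal N) (hN : ¬ N ≤ Subgroup.center (GL (Fin n) D)) :
    specialLinearSubgroup n D ≤ N := by
  have hD : 3 < ENat.card D := ENat.card_eq_top_of_infinite (α := D) ▸ ENat.natCast_lt_top 3
  obtain ⟨r, S, h0, rfl, hS⟩ := hsub
  have hle (i : ℕ) (hi : i ≤ r) : S r ≤ S i := by
    induction hi using Nat.decreasingInduction with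
    | self => exact le_rfl
    | of_succ k hk ih => exact ih.trans (hS k hk).1
  have H (i : ℕ) (hi : i ≤ r) : specialLinearSubgroup n D ≤ S i := by
    induction i with
    | zero => exact h0 ▸ le_top
    | succ i ih =>
      specialize ih (Nat.le_of_succ_le hi)
      obtain ⟨hle', hnorm | hfin⟩ := hS i hi
      · exact specialLinearSubgroup_le_of_le_normalizer hD
          (fun h => hN ((hle _ hi).trans h))
          (ih.trans ((Subgroup.normal_subgroupOf_iff_le_normalizer hle').1 hnorm))
      · exact specialLinearSubgroup_le_of_relIndex_ne_zero
          (Subgroup.relIndex_ne_zero_trans hfin.index_ne_zero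
            (Subgroup.relIndex_eq_one.2 ih ▸ one_ne_zero))
  exact H r le_rfl

end AlmostSubnormal

lemma IsAlmostSubnormal.of_isSubnormal {G : Type*} [Group G] {H : Subgroup G}
    (hH : H.IsSubnormal) : IsAlmostSubnormal H := by
  obtain ⟨r, f, hmono, hnormal, rfl, hr⟩ := Subgroup.IsSubnormal.isSubnormal_iff.1 hH
  refine ⟨r, fun i => f (r - i), by simpa using hr, by simp, fun i hi => ?_⟩
  have hsucc : r - i = r - (i + 1) + 1 := by lia
  beta_reduce
  rw [hsucc]
  exact ⟨hmono (Nat.le_succ _), .inl (hnormal _)⟩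

theorem theorem3p4 {D : Type*} [DivisionRing D] [Infinite D] (n : ℕ) (hn : 2 ≤ n)
    (N : Subgroup (Matrix.GeneralLinearGroup (Fin n) D))
    (hN : ¬ N ≤ Subgroup.center (Matrix.GeneralLinearGroup (Fin n) D)) :
    List.TFAE [
      IsAlmostSubnormal N,
      N.IsSubnormal,
      N.Normal,
      specialLinearSubgroup n D ≤ N] := by
  have : Nontrivial (Fin n) := Fin.nontrivial_iff_two_le.2 hn
  tfae_have 1 → 4 := fun h => h.specialLinearSubgroup_le hN
  tfae_have 4 → 3 := normal_of_specialLinearSubgroup_le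
  tfae_have 3 → 2 := Subgroup.Normal.isSubnormal
  tfae_have 2 → 1 := IsAlmostSubnormal.of_isSubnormal
  tfae_finish
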